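/- Let $k \ge 9$ and $\Sigma_k=\{0,1,\dots,k-1\}$. A word $w=a_0a_1\cdots a_{\ell-1}\in\Sigma_k^*$, read least significant digit first, represents the number $\mathrm{val}(w)=\sum_{i=0}^{\ell-1}a_ik^i$ (the empty word represents $0$); call $w$ a proper notation if it is empty or $a_{\ell-1}\neq 0$, so that every natural number has exactly one proper notation. For languages $K,L\subseteq\Sigma_k^*$ of proper notations, let $K\oplus L$ be the set of all proper notations $w$ with $\mathrm{val}(w)=\mathrm{val}(u)+\mathrm{val}(v)$ for some $u\in K$, $v\in L$. An NFA has a finite set of states, a single initial state, a set of accepting states, and a transition function $\delta:Q\times\Sigma_k\to 2^Q$ (no $\varepsilon$-transitions). For $m,n\ge 1$ let $f_k(m,n)$, the nondeterministic state complexity of positional addition, be the least number $s$ such that, for every $m$-state NFA $A$ and every $n$-state NFA $B$ over $\Sigma_k$ whose languages $L(A)$, $L(B)$ consist of proper notations, the language $L(A)\oplus L(B)$ is recognized by an $s$-state NFA over $\Sigma_k$. Theorem. For every $k\ge 9$ and all $m,n\ge 1$, the number $f_k(m,n)$ exists and $$f_k(m,n)=\begin{cases}6, & \text{if } m=n=1,\\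 2mn+2m+2n+1, & \text{if } m+n\ge 3.\end{cases}$$ -/

import Mathlib

namespace PosAdd

/-- The number represented by a word of base-`k` digits, read least significant digit first:
`a₀ a₁ … a_{l-1}` represents `∑ i, a_i * k ^ i`; the empty word represents `0`. -/
def value {k : ℕ} (w : List (Fin k)) : ℕ :=
  Nat.ofDigits k (w.map Fin.val)

/-- A word, read least significant digit first, is a proper notation of a number if its most
significant digit, which is its last letter, is not `0`. The empty word is a proper notation. -/
def IsNotation {k : ℕ} (w : List (Fin k)) : Prop :=
  ∀ h : w ≠ [], (w.getLast h).val ≠ 0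

/-- Positional addition of languages of notations, least significant digit first: the language
of the proper notations of all sums of a number represented in `K` and a number represented
in `L`. -/
def add {k : ℕ} (K L : Language (Fin k)) : Language (Fin k) :=
  {w | IsNotation w ∧ ∃ u ∈ K, ∃ v ∈ L, value w = value u + value v}

/-- `L` is recognized by a nondeterministic finite automaton with exactly `s` states and a single
initial state (no moves on the empty word). -/
def Recognized {k : ℕ} (s : ℕ) (L : Language (Fin k)) : Prop :=
  ∃ M : NFA (Fin k) (Fin s), (∃ q₀, M.start = {q₀}) ∧ M.accepts = L

/-- The numbers `s` such that `s` states are sufficient to recognize `K ⊕ L` for all languages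
`K`, `L` of proper notations that are recognized by automata with `m` and `n` states. -/
def sufficientStates (k m n : ℕ) : Set ℕ :=
  {s | ∀ K L : Language (Fin k), Recognized m K → Recognized n L →
    (∀ w ∈ K, IsNotation w) → (∀ w ∈ L, IsNotation w) → Recognized s (add K L)}

/-- The nondeterministic state complexity `f_k(m, n)` of positional addition: the least
sufficient number of states. -/
noncomputable def stateComplexity (k m n : ℕ) : ℕ :=
  sInf (sufficientStates k m n)

end PosAdd

namespace PosAdd

/-! ### Values of words and proper notations -/

section Value

variable {k : ℕ}

/-! Upper bound. Let each summand be followed by zeros, which costs one extra state `none` per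
automaton (`pad`), and run both padded automata in parallel with a carry bit (`addNFA`). This gives
2(m+1)(n+1) states. The state `(none, none, true)` is unreachable, because two zero digits and a
carry of at most 1 produce no carry, so 2(m+1)(n+1) - 1 = 2mn+2m+2n+1 states suffice. If m = n = 1,
then the two states with carry in which exactly one summand has ended are reached by the same words
whenever both are reachable; merging them leaves 6.

Lower bound. The witnesses are two cycles, `cycleA` on the digits 2 and k-1 and `cycleB` on 4 and
k-1, chosen so that the digit of the sum mostly reveals both summand digits and both carries. A
plain fooling set is out of reach, since reaching `(some 0, none, true)` may also reach `(none, some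
1, true)`. `card_le_of_fooling` therefore uses a rank: prefixes may lead to extra states of smaller
rank, and suffixes may be accepted from extra states of larger rank. Then of two mixed words at most
one is accepted, so distinct states of `addNFA` force distinct states of any equivalent automaton.
-/

theorem value_append_singleton (w : List (Fin k)) (d : Fin k) :
    value (w ++ [d]) = value w + d.val * k ^ w.length := by
  simp [value, Nat.ofDigits_append, mul_comm]

theorem value_lt (hk : 1 < k) (w : List (Fin k)) : value w < k ^ w.length := by
  have h := Nat.ofDigits_lt_base_pow_length (b := k) (l := w.map Fin.val) hk (by
    intro x hx
    obtain ⟨y, -, rfl⟩ := List.mem_map.1 hx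
    exact y.isLt)
  simpa [value] using h

theorem isNotation_append_singleton (w : List (Fin k)) (d : Fin k) :
    IsNotation (w ++ [d]) ↔ d.val ≠ 0 := by
  simp [IsNotation]

/-- Turns properness into an inequality on values, which can then be passed from a summand to the
sum. -/
theorem isNotation_iff_pow_le (hk : 1 < k) (w : List (Fin k)) :
    IsNotation w ↔ w = [] ∨ k ^ w.length ≤ value w * k := by
  rcases List.eq_nil_or_concat w with rfl | ⟨w, d, rfl⟩
  · simp [IsNotation]
  · rw [List.concat_eq_append, isNotation_append_singleton, value_append_singleton]
    have h := value_lt hk w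
    simp only [List.append_eq_nil_iff, List.cons_ne_self, and_false, false_or,
      List.length_append, List.length_singleton, pow_succ]
    constructor
    · intro hd
      have : 1 * k ^ w.length ≤ d.val * k ^ w.length :=
        Nat.mul_le_mul_right _ (Nat.pos_of_ne_zero hd)
      exact Nat.mul_le_mul_right _ (by omega)
    · intro hd h0
      have := Nat.le_of_mul_le_mul_right hd (by omega)
      rw [h0] at this
      omega

theorem value_append_replicate_zero [NeZero k] (w : List (Fin k)) (r : ℕ) :
    value (w ++ List.replicate r 0) = value w := by
  simp [value, Nat.ofDigits_append_replicate_zero]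

/-- Ensures that a summand can be padded with zeros to the length of the sum. -/
theorem length_le_of_value_le (hk : 1 < k) {u w : List (Fin k)} (hu : IsNotation u)
    (h : value u ≤ value w) : u.length ≤ w.length := by
  rcases (isNotation_iff_pow_le hk u).1 hu with rfl | hu
  · simp
  · have h2 : k ^ u.length < k ^ (w.length + 1) := by
      calc k ^ u.length ≤ value u * k := hu
        _ ≤ value w * k := Nat.mul_le_mul_right _ h
        _ < k ^ w.length * k := Nat.mul_lt_mul_of_pos_right (value_lt hk w) (by omega)
        _ = k ^ (w.length + 1) := (pow_succ _ _).symm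
    have := (Nat.pow_lt_pow_iff_right hk).1 h2
    omega

theorem add_comm_language (K L : Language (Fin k)) : add K L = add L K := by
  ext w
  constructor
  · rintro ⟨hw, u, hu, v, hv, h⟩
    exact ⟨hw, v, hv, u, hu, by omega⟩
  · rintro ⟨hw, u, hu, v, hv, h⟩
    exact ⟨hw, v, hv, u, hu, by omega⟩

theorem eq_and_eq_of_add_mul_eq {x y s t N : ℕ} (hx : x < N) (hy : y < N)
    (h : x + s * N = y + t * N) : x = y ∧ s = t := by
  have h1 := congrArg (· % N) h
  simp only [Nat.add_mul_mod_self_right, Nat.mod_eq_of_lt hx, Nat.mod_eq_of_lt hy] at h1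
  refine ⟨h1, Nat.eq_of_mul_eq_mul_right (by omega : 0 < N) (by omega)⟩

end Value

/-! ### Padding with zeros and the automaton for the sum -/

section Pad

variable {k : ℕ} [NeZero k] {P Q : Type*}

/-- The automaton recognizing the words of `A` followed by any number of zeros; the state `none`
means that the word of `A` has ended. -/
def pad (A : NFA (Fin k) P) : NFA (Fin k) (Option P) where
  step s a := {t | (∃ p p', s = some p ∧ t = some p' ∧ p' ∈ A.step p a) ∨
    (a = 0 ∧ t = none ∧ ∀ p, s = some p → p ∈ A.accept)}
  start := {t | ∃ p ∈ A.start, t = some p}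
  accept := {t | ∀ p, t = some p → p ∈ A.accept}

theorem some_mem_pad_eval (A : NFA (Fin k) P) (p : P) (w : List (Fin k)) :
    some p ∈ (pad A).eval w ↔ p ∈ A.eval w := by
  induction w using List.reverseRecOn generalizing p with
  | nil => simp [pad]
  | append_singleton w d ih =>
    rw [NFA.eval_append_singleton, NFA.eval_append_singleton, NFA.mem_stepSet, NFA.mem_stepSet]
    constructor
    · rintro ⟨s, hs, ⟨q, q', rfl, h, h'⟩ | ⟨-, h, -⟩⟩
      · cases h
        exact ⟨q, (ih q).1 hs, h'⟩
      · cases h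
    · rintro ⟨q, hq, h⟩
      exact ⟨some q, (ih q).2 hq, Or.inl ⟨q, p, rfl, rfl, h⟩⟩

theorem none_mem_pad_eval (A : NFA (Fin k) P) (w : List (Fin k)) :
    none ∈ (pad A).eval w ↔ ∃ u ∈ A.accepts, ∃ r, w = u ++ List.replicate (r + 1) 0 := by
  induction w using List.reverseRecOn with
  | nil =>
    simp [pad]
  | append_singleton w d ih =>
    rw [NFA.eval_append_singleton, NFA.mem_stepSet]
    constructor
    · rintro ⟨s, hs, ⟨q, q', rfl, h, h'⟩ | ⟨rfl, -, h⟩⟩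
      · cases h
      · cases s with
        | none =>
          obtain ⟨u, hu, r, rfl⟩ := ih.1 hs
          exact ⟨u, hu, r + 1, by rw [List.append_assoc, ← List.replicate_succ']⟩
        | some p =>
          exact ⟨w, ⟨p, h p rfl, (some_mem_pad_eval A p w).1 hs⟩, 0, rfl⟩
    · rintro ⟨u, hu, r, h⟩
      rw [List.replicate_succ', ← List.append_assoc] at h
      obtain ⟨rfl, h⟩ := List.append_inj' h rfl
      obtain rfl : d = 0 := by simpa using h
      cases r with
      | zero =>
        obtain ⟨p, hp, hp'⟩ := hu
        exact ⟨some p, (some_mem_pad_eval A p _).2 (by simpa using hp'),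
          Or.inr ⟨rfl, rfl, by simpa using hp⟩⟩
      | succ r => exact ⟨none, ih.2 ⟨u, hu, r, rfl⟩, Or.inr ⟨rfl, rfl, by simp⟩⟩

theorem exists_mem_pad_accept (A : NFA (Fin k) P) (w : List (Fin k)) :
    (∃ s ∈ (pad A).accept, s ∈ (pad A).eval w) ↔
      ∃ u ∈ A.accepts, ∃ r, w = u ++ List.replicate r 0 := by
  constructor
  · rintro ⟨s, hs, hw⟩
    cases s with
    | none =>
      obtain ⟨u, hu, r, h⟩ := (none_mem_pad_eval A w).1 hw
      exact ⟨u, hu, r + 1, h⟩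
    | some p =>
      exact ⟨w, ⟨p, hs p rfl, (some_mem_pad_eval A p w).1 hw⟩, 0, by simp⟩
  · rintro ⟨u, hu, r, h⟩
    cases r with
    | zero =>
      obtain ⟨p, hp, hp'⟩ := hu
      refine ⟨some p, by simpa [pad] using hp, (some_mem_pad_eval A p w).2 ?_⟩
      simpa [h] using hp'
    | succ r =>
      exact ⟨none, by simp [pad], (none_mem_pad_eval A w).2 ⟨u, hu, r, h⟩⟩

/-- At least one padding zero has been read, so the most significant digit contributes nothing. -/
theorem value_mul_lt_of_none_mem_pad_eval (hk : 1 < k) (A : NFA (Fin k) P) (w : List (Fin k))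
    (h : none ∈ (pad A).eval w) : value w * k < k ^ w.length := by
  obtain ⟨u, -, r, rfl⟩ := (none_mem_pad_eval A w).1 h
  rw [value_append_replicate_zero]
  calc value u * k < k ^ u.length * k := Nat.mul_lt_mul_of_pos_right (value_lt hk u) (by omega)
    _ = k ^ (u.length + 1) := (pow_succ _ _).symm
    _ ≤ _ := Nat.pow_le_pow_right (by omega) (by simp)

theorem eq_zero_of_none_mem_pad_step (A : NFA (Fin k) P) {s : Option P} {a : Fin k}
    (h : none ∈ (pad A).step s a) : a.val = 0 := by
  obtain ⟨_, _, -, h, -⟩ | ⟨rfl, -⟩ := h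
  · cases h
  · simp

theorem eq_none_of_mem_pad_step_none (A : NFA (Fin k) P) {t : Option P} {a : Fin k}
    (h : t ∈ (pad A).step none a) : t = none := by
  obtain ⟨_, _, h, -⟩ | ⟨-, h, -⟩ := h
  · cases h
  · exact h

/-- The automaton for the sum: it runs the padded automata for both summands in parallel and
remembers the carry. -/
def addNFA (A : NFA (Fin k) P) (B : NFA (Fin k) Q) : NFA (Fin k) (Option P × Option Q × Bool) where
  step s d := {t | ∃ a b : Fin k, t.1 ∈ (pad A).step s.1 a ∧ t.2.1 ∈ (pad B).step s.2.1 b ∧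
    a.val + b.val + s.2.2.toNat = d.val + k * t.2.2.toNat ∧
    (t.1 = none → t.2.1 = none → s.2.2 = true)}
  start := {t | t.1 ∈ (pad A).start ∧ t.2.1 ∈ (pad B).start ∧ t.2.2 = false}
  accept := {t | t.1 ∈ (pad A).accept ∧ t.2.1 ∈ (pad B).accept ∧ t.2.2 = false}

/-- The invariant of column addition. Properness is tracked only when both summands have ended: the
last digit is then the incoming carry, which the side condition in `addNFA` forces to be 1. -/
theorem mem_addNFA_eval (hk : 1 < k) (A : NFA (Fin k) P) (B : NFA (Fin k) Q) (w : List (Fin k))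
    (t : Option P × Option Q × Bool) :
    t ∈ (addNFA A B).eval w ↔ ∃ u v : List (Fin k), u.length = w.length ∧ v.length = w.length ∧
      t.1 ∈ (pad A).eval u ∧ t.2.1 ∈ (pad B).eval v ∧
      value u + value v = value w + t.2.2.toNat * k ^ w.length ∧
      (t.1 = none → t.2.1 = none → IsNotation w) := by
  induction w using List.reverseRecOn generalizing t with
  | nil =>
    simp only [List.length_nil, List.length_eq_zero_iff]
    constructor
    · rintro ⟨h1, h2, h3⟩
      exact ⟨[], [], rfl, rfl, h1, h2, by simp [h3, value], by simp [IsNotation]⟩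
    · rintro ⟨u, v, rfl, rfl, h1, h2, h3, -⟩
      refine ⟨h1, h2, ?_⟩
      cases h : t.2.2
      · rfl
      · simp [h] at h3
        simp [value] at h3
  | append_singleton w d ih =>
    rw [NFA.eval_append_singleton, NFA.mem_stepSet]
    constructor
    · rintro ⟨s, hs, a, b, ha, hb, hd, hn⟩
      obtain ⟨u, v, hu, hv, hsu, hsv, hval, -⟩ := (ih s).1 hs
      refine ⟨u ++ [a], v ++ [b], by simp [hu], by simp [hv], ?_, ?_, ?_, ?_⟩
      · rw [NFA.eval_append_singleton, NFA.mem_stepSet]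
        exact ⟨_, hsu, ha⟩
      · rw [NFA.eval_append_singleton, NFA.mem_stepSet]
        exact ⟨_, hsv, hb⟩
      · rw [value_append_singleton, value_append_singleton, value_append_singleton, hu, hv,
          List.length_append, List.length_singleton, pow_succ]
        linear_combination hval + k ^ w.length * hd
      · intro h1 h2
        rw [isNotation_append_singleton]
        intro hd0
        have hs1 := hn h1 h2
        rw [h1] at ha
        rw [h2] at hb
        have ha0 := eq_zero_of_none_mem_pad_step A ha
        have hb0 := eq_zero_of_none_mem_pad_step B hb
        rw [ha0, hb0, hs1, hd0] at hd
        cases ht : t.2.2 <;> rw [ht] at hd <;> simp at hd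
        omega
    · rintro ⟨u, v, hu, hv, htu, htv, hval, hn⟩
      obtain rfl | ⟨u, a, rfl⟩ := List.eq_nil_or_concat u
      · simp at hu
      obtain rfl | ⟨v, b, rfl⟩ := List.eq_nil_or_concat v
      · simp at hv
      simp only [List.concat_eq_append, List.length_append, List.length_singleton,
        Nat.add_right_cancel_iff] at hu hv htu htv hval
      rw [NFA.eval_append_singleton, NFA.mem_stepSet] at htu htv
      obtain ⟨s₁, hs₁, ha⟩ := htu
      obtain ⟨s₂, hs₂, hb⟩ := htv
      simp only [value_append_singleton, hu, hv, pow_succ] at hval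
      have hu' := value_lt hk u
      have hv' := value_lt hk v
      have hw' := value_lt hk w
      rw [hu] at hu'
      rw [hv] at hv'
      obtain ⟨c, hc, hd⟩ : ∃ c : Bool, value u + value v = value w + c.toNat * k ^ w.length ∧
          a.val + b.val + c.toNat = d.val + k * t.2.2.toNat := by
        -- The carry into the last column is 1 exactly when the sum of the prefixes overflows.
        by_cases hlt : value u + value v < k ^ w.length
        · obtain ⟨h1, h2⟩ := eq_and_eq_of_add_mul_eq (s := a.val + b.val)
            (t := d.val + k * t.2.2.toNat) hlt hw' (by linear_combination hval)
          exact ⟨false, by simpa using h1, by simpa using h2⟩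
        · obtain ⟨h1, h2⟩ := eq_and_eq_of_add_mul_eq (s := a.val + b.val + 1)
            (t := d.val + k * t.2.2.toNat) (x := value u + value v - k ^ w.length)
            (y := value w) (N := k ^ w.length) (by omega) hw' (by
              have : value u + value v - k ^ w.length + k ^ w.length = value u + value v := by
                omega
              linear_combination hval + this)
          exact ⟨true, by simp; omega, by simpa using h2⟩
      have key : t.1 = none → t.2.1 = none → c = true := by
        intro h1 h2
        have hd0 := (isNotation_append_singleton w d).1 (hn h1 h2)
        rw [h1] at ha
        rw [h2] at hb
        have ha0 := eq_zero_of_none_mem_pad_step A ha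
        have hb0 := eq_zero_of_none_mem_pad_step B hb
        cases c
        · simp [ha0, hb0] at hd
          omega
        · rfl
      refine ⟨(s₁, s₂, c), (ih _).2 ⟨u, v, hu, hv, hs₁, hs₂, hc, ?_⟩, a, b, ha, hb, hd, key⟩
      -- Both summands cannot have ended one letter earlier: by `key` there would be a carry, but
      -- both prefixes end in 0, so their sum is less than 2 * k ^ (length - 1) and does not
      -- overflow.
      intro h1 h2
      dsimp only at h1 h2
      subst h1 h2
      have hct := key (eq_none_of_mem_pad_step_none A ha) (eq_none_of_mem_pad_step_none B hb)
      have h1 := value_mul_lt_of_none_mem_pad_eval hk A u hs₁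
      have h2 := value_mul_lt_of_none_mem_pad_eval hk B v hs₂
      rw [hu] at h1
      rw [hv] at h2
      rw [hct] at hc
      simp only [Bool.toNat_true, one_mul] at hc
      exfalso
      have h3 : (value u + value v) * k < 2 * k ^ w.length := by
        rw [add_mul]
        omega
      have h4 : k ^ w.length * 2 ≤ (value u + value v) * k :=
        Nat.mul_le_mul (by omega) hk
      omega

theorem addNFA_accepts (hk : 1 < k) (A : NFA (Fin k) P) (B : NFA (Fin k) Q)
    (hA : ∀ w ∈ A.accepts, IsNotation w) (hB : ∀ w ∈ B.accepts, IsNotation w) :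
    (addNFA A B).accepts = add A.accepts B.accepts := by
  ext w
  constructor
  · rintro ⟨t, ⟨h1, h2, h3⟩, ht⟩
    obtain ⟨u, v, hu, hv, htu, htv, hval, hn⟩ := (mem_addNFA_eval hk A B w t).1 ht
    obtain ⟨u', hu', r, hur⟩ := (exists_mem_pad_accept A u).1 ⟨_, h1, htu⟩
    obtain ⟨v', hv', r', hvr⟩ := (exists_mem_pad_accept B v).1 ⟨_, h2, htv⟩
    simp only [h3, Bool.toNat_false, zero_mul, add_zero] at hval
    refine ⟨?_, u', hu', v', hv', ?_⟩
    -- An unended summand is itself a proper notation of full length, and the sum is at least as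
    -- large; if both have ended, the invariant applies.
    · rw [isNotation_iff_pow_le hk]
      by_cases hw : w = []
      · exact Or.inl hw
      right
      cases ht1 : t.1 with
      | some p =>
        rw [ht1] at h1 htu
        have := hA u ⟨p, h1 p rfl, (some_mem_pad_eval A p u).1 htu⟩
        rw [isNotation_iff_pow_le hk, hu] at this
        rcases this with rfl | h
        · exact absurd (List.length_eq_zero_iff.1 hu.symm) hw
        · exact h.trans (Nat.mul_le_mul_right _ (by omega))
      | none =>
        cases ht2 : t.2.1 with
        | some q =>
          rw [ht2] at h2 htv
          have := hB v ⟨q, h2 q rfl, (some_mem_pad_eval B q v).1 htv⟩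
          rw [isNotation_iff_pow_le hk, hv] at this
          rcases this with rfl | h
          · exact absurd (List.length_eq_zero_iff.1 hv.symm) hw
          · exact h.trans (Nat.mul_le_mul_right _ (by omega))
        | none => exact ((isNotation_iff_pow_le hk w).1 (hn ht1 ht2)).resolve_left hw
    · rw [← hval, hur, hvr, value_append_replicate_zero, value_append_replicate_zero]
  · rintro ⟨hw, u, hu, v, hv, h⟩
    have hul := length_le_of_value_le hk (w := w) (hA u hu) (by omega)
    have hvl := length_le_of_value_le hk (w := w) (hB v hv) (by omega)
    obtain ⟨s₁, hs₁, hs₁'⟩ := (exists_mem_pad_accept A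
      (u ++ List.replicate (w.length - u.length) 0)).2 ⟨u, hu, _, rfl⟩
    obtain ⟨s₂, hs₂, hs₂'⟩ := (exists_mem_pad_accept B
      (v ++ List.replicate (w.length - v.length) 0)).2 ⟨v, hv, _, rfl⟩
    refine ⟨(s₁, s₂, false), ⟨hs₁, hs₂, rfl⟩, (mem_addNFA_eval hk A B w _).2
      ⟨_, _, ?_, ?_, hs₁', hs₂', ?_, fun _ _ => hw⟩⟩
    · simp; omega
    · simp; omega
    · rw [value_append_replicate_zero, value_append_replicate_zero]
      simp [h]

theorem none_none_true_notMem_addNFA_eval (hk : 1 < k) (A : NFA (Fin k) P) (B : NFA (Fin k) Q)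
    (w : List (Fin k)) : (none, none, true) ∉ (addNFA A B).eval w := by
  rcases List.eq_nil_or_concat w with rfl | ⟨w, d, rfl⟩
  · rintro ⟨-, -, h⟩
    cases h
  · rw [List.concat_eq_append, NFA.eval_append_singleton, NFA.mem_stepSet]
    rintro ⟨s, -, a, b, ha, hb, hd, -⟩
    have ha0 := eq_zero_of_none_mem_pad_step A ha
    have hb0 := eq_zero_of_none_mem_pad_step B hb
    have := Bool.toNat_le s.2.2
    simp [ha0, hb0] at hd
    omega

end Pad

/-! ### Merging states and the general upper bound -/

section Recognized

variable {k : ℕ}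

/-- Reachable states with equal image are reached by the same words, so by induction the quotient
reaches exactly the image of what `M` reaches. Unreachable states do not matter. -/
theorem accepts_eq_of_image {α σ τ : Type*} (M : NFA α σ) (f : σ → τ)
    (hf : ∀ w w' a b, a ∈ M.eval w → b ∈ M.eval w' → f a = f b → b ∈ M.eval w) (N : NFA α τ)
    (hstart : N.start = f '' M.start)
    (hstep : ∀ t d, N.step t d = f '' {b | ∃ w, ∃ a ∈ M.eval w, f a = t ∧ b ∈ M.step a d})
    (haccept : N.accept = f '' {a | (∃ w, a ∈ M.eval w) ∧ a ∈ M.accept}) :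
    N.accepts = M.accepts := by
  have key : ∀ w, N.eval w = f '' M.eval w := by
    intro w
    induction w using List.reverseRecOn with
    | nil => exact hstart
    | append_singleton w d ih =>
      rw [NFA.eval_append_singleton, NFA.eval_append_singleton, ih]
      ext t
      simp only [NFA.mem_stepSet, hstep, Set.mem_image]
      constructor
      · rintro ⟨_, ⟨a, ha, rfl⟩, b, ⟨w', a', ha', haa', hb⟩, rfl⟩
        exact ⟨b, ⟨a', hf w w' a a' ha ha' haa'.symm, hb⟩, rfl⟩
      · rintro ⟨b, ⟨a, ha, hb⟩, rfl⟩
        exact ⟨f a, ⟨a, ha, rfl⟩, b, ⟨w, a, ha, rfl, hb⟩, rfl⟩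
  ext w
  change (∃ t ∈ N.accept, t ∈ N.eval w) ↔ ∃ s ∈ M.accept, s ∈ M.eval w
  rw [key, haccept]
  constructor
  · rintro ⟨_, ⟨a, ⟨⟨w', ha'⟩, haa⟩, rfl⟩, ⟨b, hb, hab⟩⟩
    exact ⟨a, haa, hf w w' b a hb ha' hab⟩
  · rintro ⟨a, ha, haw⟩
    exact ⟨f a, ⟨a, ⟨⟨w, haw⟩, ha⟩, rfl⟩, a, haw, rfl⟩

theorem recognized_of_map {σ : Type*} (M : NFA (Fin k) σ) {q₀ : σ} (hq : M.start = {q₀}) {s : ℕ}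
    (f : σ → Fin s)
    (hf : ∀ w w' a b, a ∈ M.eval w → b ∈ M.eval w' → f a = f b → b ∈ M.eval w) :
    Recognized s M.accepts :=
  ⟨⟨fun t d => f '' {b | ∃ w, ∃ a ∈ M.eval w, f a = t ∧ b ∈ M.step a d}, {f q₀},
    f '' {a | (∃ w, a ∈ M.eval w) ∧ a ∈ M.accept}⟩, ⟨f q₀, rfl⟩,
    accepts_eq_of_image M f hf _ (by simp [hq]) (fun _ _ => rfl) rfl⟩

theorem start_addNFA [NeZero k] {P Q : Type*} {A : NFA (Fin k) P} {B : NFA (Fin k) Q}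
    {p : P} {q : Q}
    (hA : A.start = {p}) (hB : B.start = {q}) :
    (addNFA A B).start = {(some p, some q, false)} := by
  ext ⟨x, y, c⟩
  simp [addNFA, pad, hA, hB]

theorem mem_sufficientStates (hk : 1 < k) (m n : ℕ) :
    2 * m * n + 2 * m + 2 * n + 1 ∈ sufficientStates k m n := by
  rintro K L ⟨A, ⟨p, hp⟩, rfl⟩ ⟨B, ⟨q, hq⟩, rfl⟩ hA hB
  have : NeZero k := ⟨by omega⟩
  rw [← addNFA_accepts hk A B hA hB]
  let S : Type := {x : Option (Fin m) × Option (Fin n) × Bool // x ≠ (none, none, true)}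
  have hcard : Fintype.card S = 2 * m * n + 2 * m + 2 * n + 1 := by
    simp only [S, ne_eq, Fintype.card_subtype_compl, Fintype.card_prod, Fintype.card_option,
      Fintype.card_fin, Fintype.card_bool, Fintype.card_unique]
    have : (m + 1) * ((n + 1) * 2) = 2 * m * n + 2 * m + 2 * n + 1 + 1 := by ring
    omega
  let e : S ≃ Fin (2 * m * n + 2 * m + 2 * n + 1) := Fintype.equivFinOfCardEq hcard
  have hne : ∀ w x, x ∈ (addNFA A B).eval w → x ≠ (none, none, true) := by
    rintro w x hx rfl
    exact none_none_true_notMem_addNFA_eval hk A B w hx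
  classical
  refine recognized_of_map _ (start_addNFA hp hq)
    -- The value 0 is arbitrary, since it is used only at the unreachable state.
    (fun x => if h : x ≠ (none, none, true) then e ⟨x, h⟩ else 0) ?_
  intro w w' a b ha hb hab
  simp only [dif_pos (hne w a ha), dif_pos (hne w' b hb), EmbeddingLike.apply_eq_iff_eq] at hab
  obtain rfl : a = b := congrArg Subtype.val hab
  exact ha

end Recognized

/-! ### Two one-state automata: six states suffice -/

section OneState

variable {k : ℕ} [NeZero k]

theorem mem_addNFA_eval_swap (hk : 1 < k) {P Q : Type*} (A : NFA (Fin k) P) (B : NFA (Fin k) Q)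
    (w : List (Fin k)) {x : Option P} {y : Option Q} {c : Bool}
    (h : (x, y, c) ∈ (addNFA A B).eval w) : (y, x, c) ∈ (addNFA B A).eval w := by
  obtain ⟨u, v, hu, hv, h1, h2, h3, h4⟩ := (mem_addNFA_eval hk A B w _).1 h
  exact (mem_addNFA_eval hk B A w _).2
    ⟨v, u, hv, hu, h2, h1, by rw [add_comm]; exact h3, fun a b => h4 b a⟩

/-- The ended summand supplies 0, so an outgoing carry needs the digit k-1 and an incoming carry. -/
theorem some_none_true_mem_addNFA_step (A B : NFA (Fin k) (Fin 1)) {d : Fin k}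
    {s : Option (Fin 1) × Option (Fin 1) × Bool}
    (h : (some 0, none, true) ∈ (addNFA A B).step s d) :
    d.val = 0 ∧ (∃ a : Fin k, a.val + 1 = k ∧ 0 ∈ A.step 0 a) ∧
      (s = (some 0, none, true) ∨ s = (some 0, some 0, true) ∧ 0 ∈ B.accept) := by
  obtain ⟨s₁, s₂, c⟩ := s
  obtain ⟨a, b, ha, hb, hd, -⟩ := h
  have hb0 := eq_zero_of_none_mem_pad_step B hb
  obtain ⟨p, p', hp, hp', hs⟩ | ⟨-, ha, -⟩ := ha
  swap
  · cases ha
  have h1 := a.isLt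
  have h2 := Bool.toNat_le c
  simp only [hb0, Bool.toNat_true, mul_one, add_zero] at hd hp hp'
  have hc : c = true := by
    cases c
    · simp at hd
      omega
    · rfl
  subst hc hp
  simp only [Bool.toNat_true] at hd
  obtain rfl := Subsingleton.elim p 0
  obtain rfl := Subsingleton.elim p' 0
  refine ⟨by omega, ⟨a, by omega, hs⟩, ?_⟩
  obtain ⟨_, _, -, hb, -⟩ | ⟨-, -, hb⟩ := hb
  · cases hb
  · cases s₂ with
    | none => exact Or.inl rfl
    | some q =>
      obtain rfl := Subsingleton.elim q 0
      exact Or.inr ⟨rfl, hb 0 rfl⟩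

theorem exists_step_of_some_none_true_mem_addNFA_eval {A B : NFA (Fin k) (Fin 1)}
    {w : List (Fin k)} (h : (some 0, none, true) ∈ (addNFA A B).eval w) :
    0 ∈ B.accept ∧ ∃ a : Fin k, a.val + 1 = k ∧ 0 ∈ A.step 0 a := by
  induction w using List.reverseRecOn with
  | nil =>
    obtain ⟨-, -, h⟩ := h
    cases h
  | append_singleton w d ih =>
    rw [NFA.eval_append_singleton, NFA.mem_stepSet] at h
    obtain ⟨s, hs, hd⟩ := h
    obtain ⟨-, h, rfl | ⟨rfl, hB⟩⟩ := some_none_true_mem_addNFA_step A B hd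
    · exact ih hs
    · exact ⟨hB, h⟩

/-- Reachability of both states makes the state of `A` accepting and gives `B` a loop on k-1. Hence
the roles can be exchanged along `w`: `B` reads k-1 where `A` did, while `A` ends and is padded. -/
theorem none_some_true_mem_of_some_none_true_mem (hk : 1 < k) {A B : NFA (Fin k) (Fin 1)}
    {w w' : List (Fin k)} (h : (some 0, none, true) ∈ (addNFA A B).eval w)
    (h' : (none, some 0, true) ∈ (addNFA A B).eval w') :
    (none, some 0, true) ∈ (addNFA A B).eval w := by
  obtain ⟨hA, b, hb, hB⟩ :=
    exists_step_of_some_none_true_mem_addNFA_eval (mem_addNFA_eval_swap hk A B w' h')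
  induction w using List.reverseRecOn with
  | nil =>
    obtain ⟨-, -, h⟩ := h
    cases h
  | append_singleton w d ih =>
    rw [NFA.eval_append_singleton, NFA.mem_stepSet] at h ⊢
    obtain ⟨s, hs, hd⟩ := h
    obtain ⟨hd, -, hs'⟩ := some_none_true_mem_addNFA_step A B hd
    have aux : ∃ x, (x, some 0, true) ∈ (addNFA A B).eval w ∧ ∀ p, x = some p → p ∈ A.accept := by
      obtain rfl | ⟨rfl, -⟩ := hs'
      · exact ⟨none, ih hs, by simp⟩
      · refine ⟨some 0, hs, fun p _ => ?_⟩
        rwa [Subsingleton.elim p 0]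
    obtain ⟨x, hx, hx'⟩ := aux
    exact ⟨_, hx, 0, b, Or.inr ⟨rfl, rfl, hx'⟩, Or.inl ⟨0, 0, rfl, rfl, hB⟩,
      by simp [hd, hb], by simp⟩

/-- The identification of states for one-state automata: the two states in which one of the words
has ended and the carry is `1` are merged. -/
def mergeState : Option (Fin 1) × Option (Fin 1) × Bool → Fin 6
  | (some _, some _, false) => 0
  | (some _, some _, true) => 1
  | (some _, none, false) => 2
  | (none, some _, false) => 3
  | (some _, none, true) => 4
  | (none, some _, true) => 4
  | (none, none, _) => 5

theorem six_mem_sufficientStates (hk : 1 < k) : 6 ∈ sufficientStates k 1 1 := by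
  rintro K L ⟨A, ⟨p, hp⟩, rfl⟩ ⟨B, ⟨q, hq⟩, rfl⟩ hA hB
  rw [← addNFA_accepts hk A B hA hB]
  refine recognized_of_map _ (start_addNFA hp hq) mergeState ?_
  intro w w' a b ha hb hab
  have ha' : a ≠ (none, none, true) := by
    rintro rfl
    exact none_none_true_notMem_addNFA_eval hk A B w ha
  have hb' : b ≠ (none, none, true) := by
    rintro rfl
    exact none_none_true_notMem_addNFA_eval hk A B w' hb
  have cases3 : a = b ∨ a = (some 0, none, true) ∧ b = (none, some 0, true) ∨
      a = (none, some 0, true) ∧ b = (some 0, none, true) := by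
    clear ha hb
    obtain ⟨_ | a₁, _ | a₂, _ | _⟩ := a <;> obtain ⟨_ | b₁, _ | b₂, _ | _⟩ := b <;>
      simp_all [mergeState, Subsingleton.elim _ (0 : Fin 1)]
  obtain rfl | ⟨rfl, rfl⟩ | ⟨rfl, rfl⟩ := cases3
  · exact ha
  · exact none_some_true_mem_of_some_none_true_mem hk ha hb
  · exact mem_addNFA_eval_swap hk B A w (none_some_true_mem_of_some_none_true_mem hk
      (mem_addNFA_eval_swap hk A B w ha) (mem_addNFA_eval_swap hk A B w' hb))

end OneState

/-! ### Ranked fooling sets -/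

section FoolingSet

theorem cons_mem_acceptsFrom_singleton {α σ : Type*} (M : NFA α σ) (s : σ) (a : α) (w : List α) :
    a :: w ∈ M.acceptsFrom {s} ↔ ∃ t ∈ M.step s a, w ∈ M.acceptsFrom {t} := by
  rw [NFA.cons_mem_acceptsFrom, NFA.stepSet_singleton]
  simp only [NFA.mem_acceptsFrom]
  constructor
  · rintro ⟨f, hf, h⟩
    obtain ⟨t, ht, h⟩ := NFA.mem_evalFrom_iff_exists.1 h
    exact ⟨t, ht, f, hf, h⟩
  · rintro ⟨t, ht, f, hf, h⟩
    exact ⟨f, hf, NFA.mem_evalFrom_iff_exists.2 ⟨t, ht, h⟩⟩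

theorem append_mem_accepts_iff {α σ : Type*} (M : NFA α σ) (x y : List α) :
    x ++ y ∈ M.accepts ↔ ∃ s ∈ M.eval x, y ∈ M.acceptsFrom {s} := by
  rw [NFA.accepts_eq_acceptsFrom_start, NFA.append_mem_acceptsFrom]
  simp only [NFA.mem_acceptsFrom]
  constructor
  · rintro ⟨f, hf, h⟩
    obtain ⟨t, ht, h⟩ := NFA.mem_evalFrom_iff_exists.1 h
    exact ⟨t, ht, f, hf, h⟩
  · rintro ⟨t, ht, f, hf, h⟩
    exact ⟨f, hf, NFA.mem_evalFrom_iff_exists.2 ⟨t, ht, h⟩⟩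

/-- A ranked fooling set given by states of an automaton `M`: each of the states `a` has a word
leading to `a`, and else only to states of smaller rank, and a word accepted from `a`, and else
only from states of larger rank; the condition `p` excludes irrelevant states. -/
theorem card_le_of_fooling {α σ τ : Type*} [Fintype τ] (M : NFA α σ) (N : NFA α τ)
    (hMN : N.accepts = M.accepts) (S : Finset σ) (r : σ → ℕ) (p : σ → Prop)
    (hp : ∀ a ∈ S, p a)
    (hx : ∀ a ∈ S, ∃ x, a ∈ M.eval x ∧ ∀ s ∈ M.eval x, s = a ∨ p s ∧ r s < r a)
    (hy : ∀ a ∈ S, ∃ y, y ∈ M.acceptsFrom {a} ∧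
      ∀ s, p s → y ∈ M.acceptsFrom {s} → s = a ∨ r a < r s) :
    S.card ≤ Fintype.card τ := by
  choose! x hx hx' using hx
  choose! y hy hy' using hy
  have hq : ∀ a ∈ S, ∃ q ∈ N.eval (x a), y a ∈ N.acceptsFrom {q} := by
    intro a ha
    rw [← append_mem_accepts_iff, hMN, append_mem_accepts_iff]
    exact ⟨a, hx a ha, hy a ha⟩
  obtain rfl | ⟨a₀, ha₀⟩ := S.eq_empty_or_nonempty
  · simp
  have : Nonempty τ := ⟨(hq a₀ ha₀).choose⟩
  choose! q hq hq' using hq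
  -- A shared state of `N` makes the mixed word `x a ++ y b` accepted; an accepting run of `M` on it
  -- passes a state of rank at most `r a` and at least `r b`.
  have key : ∀ a ∈ S, ∀ b ∈ S, q a = q b → a = b ∨ r b < r a := by
    intro a ha b hb hab
    have : x a ++ y b ∈ M.accepts := by
      rw [← hMN, append_mem_accepts_iff]
      exact ⟨q a, hq a ha, hab ▸ hq' b hb⟩
    obtain ⟨s, hs, hsy⟩ := (append_mem_accepts_iff M _ _).1 this
    obtain rfl | ⟨hsS, hlt⟩ := hx' a ha s hs
    · exact hy' b hb s (hp s ha) hsy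
    · obtain rfl | hlt' := hy' b hb s hsS hsy
      · exact Or.inr hlt
      · exact Or.inr (hlt'.trans hlt)
  refine Finset.card_le_card_of_injOn q (fun _ _ => Finset.mem_univ _) ?_
  intro a ha b hb hab
  obtain h | h := key a ha b hb hab
  · exact h
  · obtain h' | h' := key b hb a ha hab.symm
    · exact h'.symm
    · omega

end FoolingSet

/-! ### The witness cycles and the transitions of their sum -/

section Cycle

theorem Fin.induction_add_one {m : ℕ} [NeZero m] {p : Fin m → Prop} (i₀ : Fin m) (h₀ : p i₀)
    (h : ∀ i, p i → p (i + 1)) (i : Fin m) : p i := by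
  have key : ∀ v (hv : v < m), p (i₀ + ⟨v, hv⟩) := by
    intro v
    induction v with
    | zero =>
      intro hv
      simpa using h₀
    | succ v ih =>
      intro hv
      have := h _ (ih (by omega))
      rw [add_assoc] at this
      convert this using 2
      apply Fin.ext
      simp [Fin.val_add, Nat.mod_eq_of_lt hv]
  simpa using key (i - i₀).val (i - i₀).isLt

theorem Fin.induction_sub_one {m : ℕ} [NeZero m] {p : Fin m → Prop} (i₀ : Fin m) (h₀ : p i₀)
    (h : ∀ i, p (i + 1) → p i) (i : Fin m) : p i := by
  have := Fin.induction_add_one (p := fun i => p (-i)) (-i₀) (by simpa using h₀)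
    (fun i hi => h _ (by simpa using hi)) (-i)
  simpa using this

variable {K m n : ℕ} [NeZero m] [NeZero n]

/-- The digit `2` moves along the cycle, the largest digit does not move. -/
def cycleA (K m : ℕ) [NeZero m] : NFA (Fin (K + 9)) (Fin m) where
  step i a := {j | a.val = 2 ∧ j = i + 1 ∨ a.val = K + 8 ∧ j = i}
  start := {0}
  accept := {0}

/-- The digit `4` and the largest digit move along the cycle. -/
def cycleB (K n : ℕ) [NeZero n] : NFA (Fin (K + 9)) (Fin n) where
  step i a := {j | (a.val = 4 ∨ a.val = K + 8) ∧ j = i + 1}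
  start := {0}
  accept := {0}

theorem isNotation_of_mem_accepts {k : ℕ} {σ : Type*} (M : NFA (Fin k) σ)
    (h : ∀ s d, d.val = 0 → M.step s d = ∅) (w : List (Fin k)) (hw : w ∈ M.accepts) :
    IsNotation w := by
  obtain ⟨t, -, ht⟩ := hw
  rcases List.eq_nil_or_concat w with rfl | ⟨w, d, rfl⟩
  · simp [IsNotation]
  · rw [List.concat_eq_append, isNotation_append_singleton]
    intro hd
    change t ∈ M.eval _ at ht
    rw [List.concat_eq_append, NFA.eval_append_singleton, NFA.mem_stepSet] at ht
    obtain ⟨s, -, hs⟩ := ht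
    simp [h s d hd] at hs

theorem isNotation_of_mem_cycleA (w : List (Fin (K + 9))) (hw : w ∈ (cycleA K m).accepts) :
    IsNotation w :=
  isNotation_of_mem_accepts _ (fun s d hd => by simp [cycleA, hd]) w hw

theorem isNotation_of_mem_cycleB (w : List (Fin (K + 9))) (hw : w ∈ (cycleB K n).accepts) :
    IsNotation w :=
  isNotation_of_mem_accepts _ (fun s d hd => by simp [cycleB, hd]) w hw

variable (K m n) in
/-- The automaton for the sum of the languages of the two cycles. -/
abbrev cycleAdd : NFA (Fin (K + 9)) (Option (Fin m) × Option (Fin n) × Bool) :=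
  addNFA (cycleA K m) (cycleB K n)

/-- The moves of the padded automaton `cycleA`, by the value of the digit. -/
def PadMoveA (K : ℕ) : Option (Fin m) → ℕ → Option (Fin m) → Prop
  | some i, a, some i' => a = 2 ∧ i' = i + 1 ∨ a = K + 8 ∧ i' = i
  | some i, a, none => a = 0 ∧ i = 0
  | none, a, none => a = 0
  | none, _, some _ => False

/-- The moves of the padded automaton `cycleB`, by the value of the digit. -/
def PadMoveB (K : ℕ) : Option (Fin n) → ℕ → Option (Fin n) → Prop
  | some i, a, some i' => a = 4 ∧ i' = i + 1 ∨ a = K + 8 ∧ i' = i + 1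
  | some i, a, none => a = 0 ∧ i = 0
  | none, a, none => a = 0
  | none, _, some _ => False

theorem mem_pad_cycleA_step (x x' : Option (Fin m)) (a : Fin (K + 9)) :
    x' ∈ (pad (cycleA K m)).step x a ↔ PadMoveA K x a.val x' := by
  cases x <;> cases x' <;> simp [pad, cycleA, PadMoveA]

theorem mem_pad_cycleB_step (x x' : Option (Fin n)) (a : Fin (K + 9)) :
    x' ∈ (pad (cycleB K n)).step x a ↔ PadMoveB K x a.val x' := by
  cases x <;> cases x' <;> simp [pad, cycleB, PadMoveB, or_and_right]

theorem PadMoveA.lt {x x' : Option (Fin m)} {a : ℕ} (h : PadMoveA K x a x') : a < K + 9 := by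
  cases x <;> cases x' <;> simp only [PadMoveA] at h <;> omega

theorem PadMoveB.lt {x x' : Option (Fin n)} {a : ℕ} (h : PadMoveB K x a x') : a < K + 9 := by
  cases x <;> cases x' <;> simp only [PadMoveB] at h <;> omega

/-- Summand digits become natural numbers, so that the transition tables below reduce to arithmetic
with 0, 2, 4 and k-1. -/
theorem mem_cycleAdd_step {s t : Option (Fin m) × Option (Fin n) × Bool} {d : Fin (K + 9)} :
    t ∈ (cycleAdd K m n).step s d ↔ ∃ a b : ℕ, PadMoveA K s.1 a t.1 ∧ PadMoveB K s.2.1 b t.2.1 ∧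
      a + b + s.2.2.toNat = d.val + (K + 9) * t.2.2.toNat ∧
      (t.1 = none → t.2.1 = none → s.2.2 = true) := by
  constructor
  · rintro ⟨a, b, ha, hb, h⟩
    exact ⟨a, b, (mem_pad_cycleA_step _ _ _).1 ha, (mem_pad_cycleB_step _ _ _).1 hb, h⟩
  · rintro ⟨a, b, ha, hb, h⟩
    exact ⟨⟨a, ha.lt⟩, ⟨b, hb.lt⟩, (mem_pad_cycleA_step _ _ _).2 ha,
      (mem_pad_cycleB_step _ _ _).2 hb, h⟩

theorem mem_step_pair_false {i : Fin m} {j : Fin n} {d : Fin (K + 9)}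
    {t : Option (Fin m) × Option (Fin n) × Bool} :
    t ∈ (cycleAdd K m n).step (some i, some j, false) d ↔
      d.val = 6 ∧ t = (some (i + 1), some (j + 1), false) ∨
      d.val = 1 ∧ t = (some (i + 1), some (j + 1), true) ∨
      (d.val = 3 ∨ d.val = K + 7) ∧ t = (some i, some (j + 1), true) ∨
      (d.val = 2 ∧ j = 0) ∧ t = (some (i + 1), none, false) ∨
      (d.val = K + 8 ∧ j = 0) ∧ t = (some i, none, false) ∨
      ((d.val = 4 ∨ d.val = K + 8) ∧ i = 0) ∧ t = (none, some (j + 1), false) := by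
  obtain ⟨d, hd⟩ := d
  obtain ⟨_ | i', _ | j', _ | _⟩ := t <;>
    simp [mem_cycleAdd_step, PadMoveA, PadMoveB, or_and_right, and_or_left, exists_or,
      and_assoc] <;>
    grind

theorem mem_step_pair_true {i : Fin m} {j : Fin n} {d : Fin (K + 9)}
    {t : Option (Fin m) × Option (Fin n) × Bool} :
    t ∈ (cycleAdd K m n).step (some i, some j, true) d ↔
      d.val = 7 ∧ t = (some (i + 1), some (j + 1), false) ∨
      d.val = 2 ∧ t = (some (i + 1), some (j + 1), true) ∨
      (d.val = 4 ∨ d.val = K + 8) ∧ t = (some i, some (j + 1), true) ∨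
      (d.val = 3 ∧ j = 0) ∧ t = (some (i + 1), none, false) ∨
      (d.val = 0 ∧ j = 0) ∧ t = (some i, none, true) ∨
      (d.val = 5 ∧ i = 0) ∧ t = (none, some (j + 1), false) ∨
      (d.val = 0 ∧ i = 0) ∧ t = (none, some (j + 1), true) ∨
      (d.val = 1 ∧ i = 0 ∧ j = 0) ∧ t = (none, none, false) := by
  obtain ⟨d, hd⟩ := d
  obtain ⟨_ | i', _ | j', _ | _⟩ := t <;>
    simp [mem_cycleAdd_step, PadMoveA, PadMoveB, or_and_right, and_or_left, exists_or,
      and_assoc] <;>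
    grind

theorem mem_step_left_false {i : Fin m} {d : Fin (K + 9)}
    {t : Option (Fin m) × Option (Fin n) × Bool} :
    t ∈ (cycleAdd K m n).step (some i, none, false) d ↔
      d.val = 2 ∧ t = (some (i + 1), none, false) ∨
      d.val = K + 8 ∧ t = (some i, none, false) := by
  obtain ⟨d, hd⟩ := d
  obtain ⟨_ | i', _ | j', _ | _⟩ := t <;>
    simp [mem_cycleAdd_step, PadMoveA, PadMoveB, or_and_right, exists_or, and_assoc] <;>
    grind

theorem mem_step_left_true {i : Fin m} {d : Fin (K + 9)}
    {t : Option (Fin m) × Option (Fin n) × Bool} :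
    t ∈ (cycleAdd K m n).step (some i, none, true) d ↔
      d.val = 3 ∧ t = (some (i + 1), none, false) ∨
      d.val = 0 ∧ t = (some i, none, true) ∨
      (d.val = 1 ∧ i = 0) ∧ t = (none, none, false) := by
  obtain ⟨d, hd⟩ := d
  obtain ⟨_ | i', _ | j', _ | _⟩ := t <;>
    simp [mem_cycleAdd_step, PadMoveA, PadMoveB, or_and_right, exists_or, and_assoc] <;>
    grind

theorem mem_step_right_false {j : Fin n} {d : Fin (K + 9)}
    {t : Option (Fin m) × Option (Fin n) × Bool} :
    t ∈ (cycleAdd K m n).step (none, some j, false) d ↔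
      (d.val = 4 ∨ d.val = K + 8) ∧ t = (none, some (j + 1), false) := by
  obtain ⟨d, hd⟩ := d
  obtain ⟨_ | i', _ | j', _ | _⟩ := t <;>
    simp [mem_cycleAdd_step, PadMoveA, PadMoveB, or_and_right, and_or_left, exists_or,
      and_assoc] <;>
    grind

theorem mem_step_right_true {j : Fin n} {d : Fin (K + 9)}
    {t : Option (Fin m) × Option (Fin n) × Bool} :
    t ∈ (cycleAdd K m n).step (none, some j, true) d ↔
      d.val = 5 ∧ t = (none, some (j + 1), false) ∨
      d.val = 0 ∧ t = (none, some (j + 1), true) ∨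
      (d.val = 1 ∧ j = 0) ∧ t = (none, none, false) := by
  obtain ⟨d, hd⟩ := d
  obtain ⟨_ | i', _ | j', _ | _⟩ := t <;>
    simp [mem_cycleAdd_step, PadMoveA, PadMoveB, or_and_right, and_or_left, exists_or,
      and_assoc] <;>
    grind

theorem notMem_step_none {d : Fin (K + 9)} {t : Option (Fin m) × Option (Fin n) × Bool} :
    t ∉ (cycleAdd K m n).step (none, none, false) d := by
  obtain ⟨_ | i', _ | j', _ | _⟩ := t <;>
    simp [mem_cycleAdd_step, PadMoveA, PadMoveB]

end Cycle

/-! ### Prefixes and suffixes of the fooling set, and the lower bounds -/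

section Words

variable {K m n : ℕ} [NeZero m] [NeZero n]

/-- A digit below `9`. -/
def digit (K t : ℕ) (h : t < 9 := by decide) : Fin (K + 9) := ⟨t, by omega⟩

@[simp]
theorem val_digit (K t : ℕ) (h : t < 9) : (digit K t h).val = t := rfl

variable (K m n) in
/-- The states that are reached by the word `w` only. -/
def Reaches (t : Option (Fin m) × Option (Fin n) × Bool) : Prop :=
  ∃ w, (cycleAdd K m n).eval w = {t}

theorem Reaches.step {s t : Option (Fin m) × Option (Fin n) × Bool} (hs : Reaches K m n s)
    (d : Fin (K + 9)) (h : ∀ t', t' ∈ (cycleAdd K m n).step s d ↔ t' = t) : Reaches K m n t := by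
  obtain ⟨w, hw⟩ := hs
  refine ⟨w ++ [d], ?_⟩
  rw [NFA.eval_append_singleton, hw, NFA.stepSet_singleton]
  ext t'
  exact h t'

theorem reaches_start : Reaches K m n (some 0, some 0, false) :=
  ⟨[], start_addNFA (A := cycleA K m) (B := cycleB K n) rfl rfl⟩

theorem reaches_pair_true (i : Fin m) (j : Fin n) : Reaches K m n (some i, some j, true) := by
  refine Fin.induction_add_one (p := fun i => ∀ j, Reaches K m n (some i, some j, true)) 0
    (fun j => ?_) (fun i hi j => ?_) i j
  · refine Fin.induction_add_one (p := fun j => Reaches K m n (some 0, some j, true)) (0 + 1)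
      ?_ (fun j hj => ?_) j
    · exact reaches_start.step (digit K 3) (by simp [mem_step_pair_false])
    · exact hj.step (digit K 4) (by simp [mem_step_pair_true])
  · have := (hi (j - 1)).step (t := (some (i + 1), some (j - 1 + 1), true)) (digit K 2)
      (by simp [mem_step_pair_true])
    simpa using this

/-- The digit 7 = 2 + 4 + 1 is unambiguous here because k ≥ 9 makes k-1 different from 7. -/
theorem reaches_pair_false (i : Fin m) (j : Fin n) : Reaches K m n (some i, some j, false) := by
  have := (reaches_pair_true (K := K) (i - 1) (j - 1)).step
    (t := (some (i - 1 + 1), some (j - 1 + 1), false)) (digit K 7) (by simp [mem_step_pair_true])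
  simpa using this

theorem reaches_left_false (i : Fin m) : Reaches K m n (some i, none, false) := by
  have := (reaches_pair_false (K := K) (i - 1) (0 : Fin n)).step
    (t := (some (i - 1 + 1), none, false)) (digit K 2) (by simp [mem_step_pair_false])
  simpa using this

theorem reaches_right_false (j : Fin n) : Reaches K m n (none, some j, false) := by
  have := (reaches_pair_false (K := K) (0 : Fin m) (j - 1)).step
    (t := (none, some (j - 1 + 1), false)) (digit K 4) (by simp [mem_step_pair_false])
  simpa using this

/-- With n ≥ 2 the state 1 of `cycleB` is not accepting, so on the digit 0 only the first summand
can end; further zeros turn the second cycle. -/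
theorem reaches_right_true (hn : 2 ≤ n) (j : Fin n) : Reaches K m n (none, some j, true) := by
  refine Fin.induction_add_one (p := fun j => Reaches K m n (none, some j, true)) (1 + 1)
    ?_ (fun j hj => ?_) j
  · exact (reaches_pair_true 0 1).step (digit K 0)
      (by simp [mem_step_pair_true, show n ≠ 1 by omega])
  · exact hj.step (digit K 0) (by simp [mem_step_right_true])

theorem reaches_done : Reaches K m n (none, none, false) :=
  (reaches_pair_true 0 0).step (digit K 1) (by simp [mem_step_pair_true])

variable (K m n) in
/-- The word `w` is accepted from the state `t`. -/
def Accepted (t : Option (Fin m) × Option (Fin n) × Bool) (w : List (Fin (K + 9))) : Prop :=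
  w ∈ (cycleAdd K m n).acceptsFrom {t}

theorem accepted_cons (t : Option (Fin m) × Option (Fin n) × Bool) (d : Fin (K + 9))
    (w : List (Fin (K + 9))) :
    Accepted K m n t (d :: w) ↔ ∃ t' ∈ (cycleAdd K m n).step t d, Accepted K m n t' w :=
  cons_mem_acceptsFrom_singleton _ _ _ _

theorem accepted_nil (x : Option (Fin m)) (y : Option (Fin n)) (c : Bool) :
    Accepted K m n (x, y, c) [] ↔
      (∀ i, x = some i → i = 0) ∧ (∀ j, y = some j → j = 0) ∧ c = false := by
  simp [Accepted, NFA.nil_mem_acceptsFrom, addNFA, pad, cycleA, cycleB]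

theorem not_accepted_cons_none (d : Fin (K + 9)) (w : List (Fin (K + 9))) :
    ¬ Accepted K m n (none, none, false) (d :: w) := by
  simp [accepted_cons, notMem_step_none]

variable (K) in
-- The digit 7 leads to acceptance only from the last position of both cycles; prepending 4 or 2
-- moves the target backwards.
theorem exists_word_pair_true (i : Fin m) (j : Fin n) : ∃ w, ∀ i' j',
    Accepted K m n (some i', some j', true) w ↔ i' = i ∧ j' = j := by
  refine Fin.induction_sub_one (p := fun i => ∀ j, ∃ w, ∀ i' j',
    Accepted K m n (some i', some j', true) w ↔ i' = i ∧ j' = j) (0 - 1)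
    (fun j => ?_) (fun i hi j => ?_) i j
  · refine Fin.induction_sub_one (p := fun j => ∃ w, ∀ i' j',
      Accepted K m n (some i', some j', true) w ↔ i' = 0 - 1 ∧ j' = j) (0 - 1)
      ?_ (fun j ⟨w, hw⟩ => ?_) j
    · refine ⟨[digit K 7], fun i' j' => ?_⟩
      simp [accepted_cons, mem_step_pair_true, accepted_nil, eq_neg_iff_add_eq_zero]
    · refine ⟨digit K 4 :: w, fun i' j' => ?_⟩
      simp [accepted_cons, mem_step_pair_true, hw]
  · obtain ⟨w, hw⟩ := hi (j + 1)
    refine ⟨digit K 2 :: w, fun i' j' => ?_⟩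
    simp [accepted_cons, mem_step_pair_true, hw]

variable (K) in
theorem exists_word_pair_false (i : Fin m) (j : Fin n) : ∃ w,
    (∀ i' j', Accepted K m n (some i', some j', false) (digit K 6 :: w) ↔
      i' = i ∧ j' = j) ∧
    ∀ x y c, (x ≠ none → y ≠ none → c = true) → (x = none → y = none → c = false) →
      ¬ Accepted K m n (x, y, c) (digit K 6 :: w) := by
  obtain ⟨w, hw⟩ := exists_word_pair_true K (i + 1) (j + 1 + 1)
  refine ⟨digit K 3 :: w, fun i' j' => ?_, fun x y c h h' => ?_⟩
  · simp [accepted_cons, mem_step_pair_false, hw]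
  · obtain _ | i' := x <;> obtain _ | j' := y <;> cases c <;>
      simp_all [accepted_cons, mem_step_pair_true, mem_step_left_false,
        mem_step_left_true, mem_step_right_false, mem_step_right_true, notMem_step_none]

variable (K) in
theorem exists_word_pair_true_only (i : Fin m) (j : Fin n) : ∃ w,
    (∀ i' j', Accepted K m n (some i', some j', true) w ↔ i' = i ∧ j' = j) ∧
    ∀ x y c, (x ≠ none → y ≠ none → c = false) → (x = none → y = none → c = false) →
      ¬ Accepted K m n (x, y, c) w := by
  -- After the digits 2 and 7 both cycles have advanced twice. States of another shape that can read
  -- 2 cannot then read 7 6.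
  obtain ⟨w, hw, hw'⟩ := exists_word_pair_false K (i + 1 + 1) (j + 1 + 1)
  refine ⟨digit K 2 :: digit K 7 :: digit K 6 :: w, fun i' j' => ?_, fun x y c h h' => ?_⟩
  · simp [accepted_cons (d := digit K 2),
      accepted_cons (d := digit K 7), mem_step_pair_true, hw]
  · obtain _ | i' := x <;> obtain _ | j' := y <;> cases c <;>
      simp_all [accepted_cons, mem_step_pair_false, mem_step_left_false,
        mem_step_left_true, mem_step_right_false, mem_step_right_true, notMem_step_none]

variable (K m n) in
-- The leading 2 is kept explicit because, once a summand has ended, only the states considered here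
-- can read it.
theorem exists_word_left_false (i : Fin m) : ∃ w, ∀ i',
    Accepted K m n (some i', none, false) (digit K 2 :: w) ↔ i' = i := by
  refine Fin.induction_sub_one (p := fun i => ∃ w, ∀ i',
    Accepted K m n (some i', none, false) (digit K 2 :: w) ↔ i' = i) (0 - 1)
    ⟨[], fun i' => ?_⟩ (fun i ⟨w, hw⟩ => ⟨digit K 2 :: w, fun i' => ?_⟩) i
  · simp [accepted_cons, mem_step_left_false, accepted_nil, eq_neg_iff_add_eq_zero]
  · rw [accepted_cons]
    simp [mem_step_left_false, hw]

variable (K m n) in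
theorem exists_word_right_false (j : Fin n) : ∃ w, ∀ j',
    Accepted K m n (none, some j', false) (digit K 4 :: w) ↔ j' = j := by
  refine Fin.induction_sub_one (p := fun j => ∃ w, ∀ j',
    Accepted K m n (none, some j', false) (digit K 4 :: w) ↔ j' = j) (0 - 1)
    ⟨[], fun j' => ?_⟩ (fun j ⟨w, hw⟩ => ⟨digit K 4 :: w, fun j' => ?_⟩) j
  · simp [accepted_cons, mem_step_right_false, accepted_nil, eq_neg_iff_add_eq_zero]
  · rw [accepted_cons]
    simp [mem_step_right_false, hw]

/-- The number of summands that have not ended, with the second summand counting less. -/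
def rank : Option (Fin m) × Option (Fin n) × Bool → ℕ
  | (some _, some _, _) => 3
  | (some _, none, _) => 2
  | (none, some _, _) => 1
  | (none, none, _) => 0

theorem exists_accepted_word (a : Option (Fin m) × Option (Fin n) × Bool)
    (ha : a ≠ (none, none, true)) : ∃ w, Accepted K m n a w ∧
    ∀ s, s ≠ (none, none, true) → Accepted K m n s w →
      s = a ∨ rank a < rank s := by
  obtain ⟨_ | i, _ | j, _ | _⟩ := a
  · refine ⟨[], by simp [accepted_nil], ?_⟩
    rintro ⟨_ | i', _ | j', _ | _⟩ <;> simp [rank]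
  · simp at ha
  · obtain ⟨w, hw⟩ := exists_word_right_false K m n j
    refine ⟨_, (hw j).2 rfl, ?_⟩
    rintro ⟨_ | i', _ | j', _ | _⟩ <;> simp [rank, hw, not_accepted_cons_none]
    simp [accepted_cons, mem_step_right_true]
  · obtain ⟨w, hw⟩ := exists_word_right_false K m n (j + 1)
    refine ⟨digit K 5 :: digit K 4 :: w, ?_, ?_⟩
    · rw [accepted_cons]
      simp [mem_step_right_true, hw]
    · rintro ⟨_ | i', _ | j', _ | _⟩ <;> simp [rank, not_accepted_cons_none] <;>
        rw [accepted_cons] <;>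
        simp [mem_step_right_false, mem_step_right_true, hw]
  · obtain ⟨w, hw⟩ := exists_word_left_false K m n i
    refine ⟨_, (hw i).2 rfl, ?_⟩
    rintro ⟨_ | i', _ | j', _ | _⟩ <;> simp [rank, hw, not_accepted_cons_none] <;>
      simp [accepted_cons, mem_step_right_true, mem_step_right_false,
        mem_step_left_true]
  · obtain ⟨w, hw⟩ := exists_word_left_false K m n (i + 1)
    refine ⟨digit K 3 :: digit K 2 :: w, ?_, ?_⟩
    · rw [accepted_cons]
      simp [mem_step_left_true, hw]
    · rintro ⟨_ | i', _ | j', _ | _⟩ <;> simp [rank, not_accepted_cons_none] <;>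
        rw [accepted_cons] <;>
        simp [mem_step_right_false, mem_step_right_true, mem_step_left_false,
          mem_step_left_true, hw]
  · obtain ⟨w, hw, hw'⟩ := exists_word_pair_false K i j
    refine ⟨_, (hw i j).2 ⟨rfl, rfl⟩, ?_⟩
    rintro ⟨_ | i', _ | j', _ | _⟩ <;> simp +contextual [hw, hw']
  · obtain ⟨w, hw, hw'⟩ := exists_word_pair_true_only K i j
    refine ⟨_, (hw i j).2 ⟨rfl, rfl⟩, ?_⟩
    rintro ⟨_ | i', _ | j', _ | _⟩ <;> simp +contextual [hw, hw']

theorem Reaches.exists_word {a : Option (Fin m) × Option (Fin n) × Bool}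
    (h : Reaches K m n a) (p : Option (Fin m) × Option (Fin n) × Bool → Prop) :
    ∃ x, a ∈ (cycleAdd K m n).eval x ∧ ∀ s ∈ (cycleAdd K m n).eval x, s = a ∨ p s := by
  obtain ⟨w, hw⟩ := h
  exact ⟨w, by simp [hw], fun s hs => Or.inl (by simpa [hw] using hs)⟩

/-- For i = 0 the first summand may end instead of the second; this unwanted state has smaller rank
because `rank` gives the second summand less weight. -/
theorem exists_word_left_true (i : Fin m) : ∃ w,
    (some i, none, true) ∈ (cycleAdd K m n).eval w ∧
    ∀ s ∈ (cycleAdd K m n).eval w, s = (some i, none, true) ∨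
      s ≠ (none, none, true) ∧ rank s < rank (some i, (none : Option (Fin n)), true) := by
  obtain ⟨w, hw⟩ := reaches_pair_true (K := K) i (0 : Fin n)
  refine ⟨w ++ [digit K 0], ?_⟩
  rw [NFA.eval_append_singleton, hw, NFA.stepSet_singleton]
  refine ⟨by simp [mem_step_pair_true], fun s hs => ?_⟩
  have : s = (some i, none, true) ∨ i = 0 ∧ s = (none, some 1, true) := by
    simpa [mem_step_pair_true] using hs
  obtain rfl | ⟨-, rfl⟩ := this
  · exact Or.inl rfl
  · exact Or.inr (by simp [rank])

theorem recognized_cycleA : Recognized m (cycleA K m).accepts := ⟨_, ⟨0, rfl⟩, rfl⟩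

theorem recognized_cycleB : Recognized n (cycleB K n).accepts := ⟨_, ⟨0, rfl⟩, rfl⟩

theorem card_le_of_mem_sufficientStates {s : ℕ} (hs : s ∈ sufficientStates (K + 9) m n)
    (S : Finset (Option (Fin m) × Option (Fin n) × Bool)) (hS : (none, none, true) ∉ S)
    (hx : ∀ a ∈ S, ∃ x, a ∈ (cycleAdd K m n).eval x ∧
      ∀ s ∈ (cycleAdd K m n).eval x, s = a ∨ s ≠ (none, none, true) ∧ rank s < rank a) :
    S.card ≤ s := by
  obtain ⟨N, -, hN⟩ := hs _ _ recognized_cycleA recognized_cycleB isNotation_of_mem_cycleA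
    isNotation_of_mem_cycleB
  rw [← addNFA_accepts (by omega) _ _ isNotation_of_mem_cycleA isNotation_of_mem_cycleB] at hN
  exact (card_le_of_fooling _ N hN S rank (· ≠ (none, none, true))
    (fun a ha => ne_of_mem_of_not_mem ha hS) hx
    (fun a ha => exists_accepted_word a (ne_of_mem_of_not_mem ha hS))).trans_eq
    (Fintype.card_fin s)

theorem le_of_mem_sufficientStates (hn : 2 ≤ n) {s : ℕ}
    (hs : s ∈ sufficientStates (K + 9) m n) : 2 * m * n + 2 * m + 2 * n + 1 ≤ s := by
  have h := card_le_of_mem_sufficientStates hs (Finset.univ.erase (none, none, true)) (by simp) (by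
    rintro ⟨_ | i, _ | j, _ | _⟩ ha
    · exact reaches_done.exists_word _
    · simp at ha
    · exact (reaches_right_false j).exists_word _
    · exact (reaches_right_true hn j).exists_word _
    · exact (reaches_left_false i).exists_word _
    · exact exists_word_left_true i
    · exact (reaches_pair_false i j).exists_word _
    · exact (reaches_pair_true i j).exists_word _)
  rw [Finset.card_erase_of_mem (Finset.mem_univ _), Finset.card_univ] at h
  simp only [Fintype.card_prod, Fintype.card_option, Fintype.card_fin, Fintype.card_bool] at h
  have : (m + 1) * ((n + 1) * 2) = 2 * m * n + 2 * m + 2 * n + 1 + 1 := by ring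
  omega

/-- Only one of the two mergeable states, `(some 0, none, true)`, enters the fooling set. -/
theorem six_le_of_mem_sufficientStates {s : ℕ} (hs : s ∈ sufficientStates (K + 9) 1 1) :
    6 ≤ s := by
  refine (le_of_eq rfl).trans (card_le_of_mem_sufficientStates hs
    {(some 0, some 0, false), (some 0, some 0, true), (some 0, none, false), (some 0, none, true),
      (none, some 0, false), (none, none, false)} (by simp) ?_)
  simp only [Finset.forall_mem_insert, Finset.mem_singleton, forall_eq]
  refine ⟨(reaches_pair_false 0 0).exists_word _, (reaches_pair_true 0 0).exists_word _,
    (reaches_left_false 0).exists_word _, exists_word_left_true 0,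
    (reaches_right_false 0).exists_word _, reaches_done.exists_word _⟩

end Words

theorem sufficientStates_comm (k m n : ℕ) : sufficientStates k m n = sufficientStates k n m := by
  have : ∀ m n, sufficientStates k m n ⊆ sufficientStates k n m := by
    intro m n s hs K L hK hL hK' hL'
    rw [add_comm_language]
    exact hs L K hL hK hL' hK'
  exact (this m n).antisymm (this n m)

theorem isLeast_stateComplexity {k m n N : ℕ} (h : IsLeast (sufficientStates k m n) N) :
    stateComplexity k m n = N :=
  h.csInf_eq

end PosAdd

theorem mainTheorem1 (k : ℕ) (hk : 9 ≤ k) (m n : ℕ) (hm : 1 ≤ m) (hn : 1 ≤ n) :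
    IsLeast (PosAdd.sufficientStates k m n) (PosAdd.stateComplexity k m n) ∧
    (m = 1 ∧ n = 1 → PosAdd.stateComplexity k m n = 6) ∧
    (3 ≤ m + n → PosAdd.stateComplexity k m n = 2 * m * n + 2 * m + 2 * n + 1) := by
  obtain ⟨K, rfl⟩ : ∃ K, k = K + 9 := ⟨k - 9, by omega⟩
  have : NeZero m := ⟨by omega⟩
  have : NeZero n := ⟨by omega⟩
  have hne : (PosAdd.sufficientStates (K + 9) m n).Nonempty :=
    ⟨_, PosAdd.mem_sufficientStates (by omega) m n⟩
  refine ⟨⟨Nat.sInf_mem hne, fun s hs => Nat.sInf_le hs⟩, ?_, fun hmn => ?_⟩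
  · rintro ⟨rfl, rfl⟩
    exact PosAdd.isLeast_stateComplexity ⟨PosAdd.six_mem_sufficientStates (by omega),
      fun s hs => PosAdd.six_le_of_mem_sufficientStates hs⟩
  · refine PosAdd.isLeast_stateComplexity ⟨PosAdd.mem_sufficientStates (by omega) m n,
      fun s hs => ?_⟩
    by_cases h2 : 2 ≤ n
    · exact PosAdd.le_of_mem_sufficientStates h2 hs
    -- Here n = 1 and m ≥ 2, so the summands are exchanged.
    · rw [PosAdd.sufficientStates_comm] at hs
      have := PosAdd.le_of_mem_sufficientStates (by omega) hs
      linarith
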